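/- Fix $\lambda_1,\lambda_2,\beta,\xi>0$. Let $\tau\sim\mathrm{Exp}(\lambda_1)$, $\tilde\tau\sim\mathrm{Exp}(\lambda_2)$ and $Y\sim\mathrm{Exp}(\beta)$ be independent. Consider a sequence $(\tau_n,Y_n)_{n\ge 0}$ of inter-claim times and claim sizes with states $J_n=1$ if $\tau_n\le\xi$ and $J_n=2$ if $\tau_n>\xi$, such that, given $(\tau_k,Y_k)_{k\le n}$, the pair $(\tau_{n+1},Y_{n+1})$ has the law of $(\tau,Y)$ if $J_n=1$ and of $(\tilde\tau,Y)$ if $J_n=2$. Let $\mathbb P_i$ be the law of this sequence started with $J_0=i$ ($\tau_0$ and $Y_0$ are fixed and only encode $J_0$), let $\mathbb E_i$ be its expectation, and let $\mathcal F_n=\sigma((\tau_k,Y_k):k\le n)$. Put $S_n=\sum_{k=1}^n(Y_k-\tau_k)$, so that $(S_n,J_n)$ is a two-state discrete-time Markov additive process. Let $\sigma_k=\tau_1+\dots+\tau_k$, $N(t)=\#\{k\ge 1:\sigma_k\le t\}$ and $U(t)=x+t-\sum_{k=1}^{N(t)}Y_k$, and let $$\psi(x)=\mathbb P_2\bigl(T(x)<\infty\bigr),\qquad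 T(x)=\inf\{t\ge 0:U(t)<0\},$$ be the ruin probability with initial reserve $x$ (the first inter-claim time being distributed as $\tilde\tau$). Let $X_1=S_{\nu}$ with $\nu=\min\{n\ge 1:J_n=2\}$, and let $\kappa>0$ be the adjustment coefficient, that is, $\mathbb E_2[e^{\kappa X_1}]=1$. Let $\hat{\mathbf F}[\kappa]$ be the $2\times 2$ matrix with entries $\hat F_{ij}[\kappa]=\mathbb E_i[e^{\kappa (S_1-S_0)};J_1=j]$, and let $v^{(\kappa)}=(v^{(\kappa)}_1,v^{(\kappa)}_2)^{T}\neq 0$ be a right eigenvector, $\hat{\mathbf F}[\kappa]v^{(\kappa)}=v^{(\kappa)}$. Theorem. There is exactly one probability measure $\mathbb Q^{(\kappa)}_2$ on the space of sequences $(\tau_n,Y_n)_{n\ge0}$ such that, for every $n\ge 0$, $$\frac{d\mathbb Q^{(\kappa)}_2}{d\mathbb P_2}\Big|_{\mathcal F_n}=L_n:=e^{\kappa S_n}\,\frac{v^{(\kappa)}_{J_n}}{v^{(\kappa)}_{J_0}} .$$ Write $\mathbb E^{(\kappa)}_2$ for its expectation. For every $x\ge 0$ let $T^{(2)}(x)=\inf\{n\ge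 0:S_n>x\}$, and let $\varepsilon(T^{(2)}(x))=S_{T^{(2)}(x)}-x$ be the overshoot. Then $T^{(2)}(x)<\infty$ holds $\mathbb Q^{(\kappa)}_2$-almost surely, the random variable below is $\mathbb Q^{(\kappa)}_2$-integrable, and $$\psi(x)=v^{(\kappa)}_2\,e^{-\kappa x}\,\mathbb E^{(\kappa)}_2\!\left[\frac{e^{-\kappa\,\varepsilon(T^{(2)}(x))}}{v^{(\kappa)}_{J_{T^{(2)}(x)}}}\right].$$ -/

import Mathlib

open MeasureTheory ProbabilityTheory
open scoped ENNReal Matrix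

noncomputable section

/-- Parameters of the exponential model: `τ ~ Exp(lam1)`, `τ̃ ~ Exp(lam2)`, claims `Y ~ Exp(beta)`
and the length `xi` of the fixed time window.  The premium rate is `1`. -/
structure BonusModel where
  lam1 : ℝ
  lam2 : ℝ
  beta : ℝ
  xi : ℝ
  lam1_pos : 0 < lam1
  lam2_pos : 0 < lam2
  beta_pos : 0 < beta
  xi_pos : 0 < xi

/-- A path `ω` lists the pairs `ω n = (τ_n, Y_n)` of inter-claim time and claim size, `n = 0, 1, …`.
The pair with index `0` only serves to encode the initial state of the environment. -/
abbrev ClaimPath : Type := ℕ → ℝ × ℝ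

namespace BonusModel

variable (M : BonusModel)

/-- State attached to an inter-claim time: `0` if it is at most `xi` ("state 1"),
`1` if it is larger than `xi` ("state 2"). -/
def state (t : ℝ) : Fin 2 := if t ≤ M.xi then 0 else 1

lemma measurable_state : Measurable M.state :=
  Measurable.ite measurableSet_Iic measurable_const measurable_const

/-- Rate of the next inter-claim time, given the state of the current one. -/
def rate (i : Fin 2) : ℝ := if i = 0 then M.lam1 else M.lam2

lemma rate_pos (i : Fin 2) : 0 < M.rate i := by
  unfold rate
  split_ifs
  exacts [M.lam1_pos, M.lam2_pos]

/-- Law of the next pair (inter-claim time, claim size) given the current state: the components are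
independent, `Exp(lam1)` or `Exp(lam2)` for the time and `Exp(beta)` for the claim. -/
def claimKernel : Kernel (Fin 2) (ℝ × ℝ) :=
  Kernel.ofFunOfCountable fun i => (expMeasure (M.rate i)).prod (expMeasure M.beta)

instance : IsMarkovKernel M.claimKernel where
  isProbabilityMeasure i := by
    have := isProbabilityMeasure_expMeasure (M.rate_pos i)
    have := isProbabilityMeasure_expMeasure M.beta_pos
    change IsProbabilityMeasure ((expMeasure (M.rate i)).prod (expMeasure M.beta))
    infer_instance

/-- Transition kernel of the path: the past enters only through the state of the last
inter-claim time. -/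
def stepKernel (n : ℕ) : Kernel (Π _ : Finset.Iic n, ℝ × ℝ) (ℝ × ℝ) :=
  M.claimKernel.comap (fun h => M.state (h ⟨n, Finset.mem_Iic.2 le_rfl⟩).1)
    (M.measurable_state.comp (measurable_fst.comp (measurable_pi_apply _)))

instance (n : ℕ) : IsMarkovKernel (M.stepKernel n) := by
  unfold stepKernel
  infer_instance

/-- The pair of index `0` that encodes `J_0 = i`: a value of `τ_0` in the state `i` and no claim. -/
def startPoint (i : Fin 2) : ℝ × ℝ := (if i = 0 then M.xi else M.xi + 1, 0)

/-- The law `P_i` of the path, started in state `J_0 = i`. -/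
def pathLaw (i : Fin 2) : Measure ClaimPath :=
  Kernel.trajMeasure (X := fun _ => ℝ × ℝ) (Measure.dirac (M.startPoint i)) M.stepKernel

/-! ### The risk process in continuous time -/

/-- Claim epochs `σ_k = τ_1 + ⋯ + τ_k`. -/
def claimEpoch (k : ℕ) (ω : ClaimPath) : ℝ := ∑ i ∈ Finset.Icc 1 k, (ω i).1

/-- Number `N(t)` of claims in `(0, t]`. -/
def claimCount (t : ℝ) (ω : ClaimPath) : ℕ := {k : ℕ | 1 ≤ k ∧ claimEpoch k ω ≤ t}.ncard

/-- Surplus `U(t) = x + t - ∑_{k ≤ N(t)} Y_k`. -/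
def surplus (x t : ℝ) (ω : ClaimPath) : ℝ :=
  x + t - ∑ k ∈ Finset.Icc 1 (claimCount t ω), (ω k).2

/-- Time of ruin `T(x) = inf {t ≥ 0 : U(t) < 0}`, infinite if there is no ruin. -/
def ruinTime (x : ℝ) (ω : ClaimPath) : ℝ≥0∞ :=
  sInf (ENNReal.ofReal '' {t : ℝ | 0 ≤ t ∧ surplus x t ω < 0})

/-- Ruin probability `ψ(x) = P(T(x) < ∞)`; the first inter-claim time is distributed as `τ̃`. -/
def ruinProb (x : ℝ) : ℝ := (M.pathLaw 1).real {ω | ruinTime x ω < ∞}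

/-! ### The embedded Markov additive process -/

/-- Additive component `S_n = ∑_{k=1}^n (Y_k - τ_k)`. -/
def S (n : ℕ) (ω : ClaimPath) : ℝ := ∑ k ∈ Finset.Icc 1 n, ((ω k).2 - (ω k).1)

/-- Markov component `J_n`, the state of `τ_n`. -/
def J (n : ℕ) (ω : ClaimPath) : Fin 2 := M.state (ω n).1

/-- Increment `X_1` of the claim surplus up to the first regeneration, that is, up to the first
claim that ends an inter-claim time larger than `xi`. -/
def cycleIncrement (ω : ClaimPath) : ℝ := S (sInf {n : ℕ | 1 ≤ n ∧ M.J n ω = 1}) ω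

/-- `κ > 0` with `E[exp (κ X_1)] = 1`.  (A non-integrable exponential has `mgf` equal to `0`, so
finiteness of the expectation is included.) -/
def IsAdjustmentCoefficient (κ : ℝ) : Prop :=
  0 < κ ∧ mgf M.cycleIncrement (M.pathLaw 1) κ = 1

/-- The matrix `F̂[θ]` with entries `E_i[exp (θ (S_1 - S_0)); J_1 = j]`. -/
def kernelMatrix (θ : ℝ) : Matrix (Fin 2) (Fin 2) ℝ := Matrix.of fun i j =>
  ∫ ω in {ω | M.J 1 ω = j}, Real.exp (θ * (S 1 ω - S 0 ω)) ∂(M.pathLaw i)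

/-- First passage `T(x) = inf {n : S_n > x}` of the additive component, `⊤` if there is none. -/
def passageTime (x : ℝ) : ClaimPath → WithTop ℕ := hittingAfter S (Set.Ioi x) 0

/-- Likelihood ratio `L_n = exp (κ S_n) v_{J_n} / v_{J_0}` for the eigenvalue `1`. -/
def likelihood (κ : ℝ) (v : Fin 2 → ℝ) (n : ℕ) (ω : ClaimPath) : ℝ :=
  Real.exp (κ * S n ω) * (v (M.J n ω) / v (M.J 0 ω))

/-- `Q` is the exponentially tilted version of `P_i`: a probability measure with `dQ / dP_i = L_n`
on the events determined by the first `n` claims, for every `n`. -/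
structure IsTiltedLaw (κ : ℝ) (v : Fin 2 → ℝ) (i : Fin 2) (Q : Measure ClaimPath) : Prop where
  isProbabilityMeasure : IsProbabilityMeasure Q
  density : ∀ (n : ℕ) (A : Set ClaimPath),
    MeasurableSet[Filtration.piLE (X := fun _ : ℕ => ℝ × ℝ) n] A →
      Q A = ∫⁻ ω in A, ENNReal.ofReal (M.likelihood κ v n ω) ∂(M.pathLaw i)

/-- Value `S_{T(x)}` of the additive component at the first passage. -/
def passageValue (x : ℝ) : ClaimPath → ℝ := stoppedValue S (passageTime x)

/-- State `J_{T(x)}` at the first passage. -/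
def passageState (x : ℝ) : ClaimPath → Fin 2 := stoppedValue M.J (passageTime x)

/-- Overshoot `S_{T(x)} - x`. -/
def overshoot (x : ℝ) (ω : ClaimPath) : ℝ := passageValue x ω - x

end BonusModel

end

/-! The proof is an exponential change of measure. If the entries of `v` have one sign, the
eigenvector equation makes the one-step factors of `L_n` positive with mean one. The tilted law is
then again a path law, driven by `tiltedKernel`, and `lintegral_chainLaw_tiltedKernel` identifies
its density on the first `n` claims. With T the passage time, P(T = n) = E_Q[1/L_n; T = n]. On that
event 1/L_n is v_2 e^{-κx} times the functional in the theorem, and summing over n gives the formula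
(`pathLaw_exists_lt_S`).

Three points need an argument.

Sign of `v`: the eigenvalue 1 might be the non-Perron one, whose eigenvector changes sign.
Finiteness of E_2[e^{κX_1}] excludes this. A diagonal entry F̂_11[κ] ≥ 1 would keep the
contributions of long cycles away from zero (`tiltMass_zero_zero_lt_one`). Once F̂_11[κ] < 1, the
first row of the equation makes v_1 a positive multiple of v_2 (`eigenvector_div_pos`).

Finiteness of T under Q: in place of a drift computation, the mean of √L_n under P decays
geometrically, because the claim size is random and independent of the inter-claim time. Since L_n
is bounded on {S_n ≤ x}, Q(S_n ≤ x) tends to 0 (`tilted_ae_exists_lt_S`).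

Ruin: the surplus increases between claims, so ruin is passage of S above x, provided that
inter-claim times are positive and claim epochs unbounded (`ruinTime_lt_top_iff`). -/

noncomputable section

namespace BonusModel

variable (M : BonusModel)

/-! ### Paths driven by a kernel that only sees the current state -/

/-- Transition kernels that see the past only through the state of the last inter-claim time. -/
def stateStep (η : Kernel (Fin 2) (ℝ × ℝ)) (n : ℕ) : Kernel (Π _ : Finset.Iic n, ℝ × ℝ) (ℝ × ℝ) :=
  η.comap (fun h => M.state (h ⟨n, Finset.mem_Iic.2 le_rfl⟩).1)
    (M.measurable_state.comp (measurable_fst.comp (measurable_pi_apply _)))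

instance (η : Kernel (Fin 2) (ℝ × ℝ)) [IsMarkovKernel η] (n : ℕ) :
    IsMarkovKernel (M.stateStep η n) := by
  unfold stateStep
  infer_instance

/-- Law of the path started in state `i` whose transitions are given by `η`. -/
def chainLaw (η : Kernel (Fin 2) (ℝ × ℝ)) [IsMarkovKernel η] (i : Fin 2) : Measure ClaimPath :=
  Kernel.trajMeasure (X := fun _ => ℝ × ℝ) (Measure.dirac (M.startPoint i)) (M.stateStep η)

instance (η : Kernel (Fin 2) (ℝ × ℝ)) [IsMarkovKernel η] (i : Fin 2) :
    IsProbabilityMeasure (M.chainLaw η i) := by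
  unfold chainLaw
  infer_instance

lemma pathLaw_eq_chainLaw (i : Fin 2) : M.pathLaw i = M.chainLaw M.claimKernel i := rfl

instance (i : Fin 2) : IsProbabilityMeasure (M.pathLaw i) := by
  rw [pathLaw_eq_chainLaw]
  infer_instance

/-- Extension of a finite history to a path. -/
def extendPath (n : ℕ) (h : Π _ : Finset.Iic n, ℝ × ℝ) : ClaimPath :=
  fun k => if hk : k ≤ n then h ⟨k, Finset.mem_Iic.2 hk⟩ else 0

lemma measurable_extendPath (n : ℕ) : Measurable (extendPath n) := by
  refine measurable_pi_iff.2 fun k => ?_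
  by_cases hk : k ≤ n
  · simpa [extendPath, hk] using measurable_pi_apply _
  · simp [extendPath, hk]

lemma extendPath_frestrictLe {n k : ℕ} (hk : k ≤ n) (ω : ClaimPath) :
    extendPath n (Preorder.frestrictLe (π := fun _ => ℝ × ℝ) n ω) k = ω k := by
  simp [extendPath, hk]

lemma _root_.DependsOn.extendPath_frestrictLe {β : Type*} {F : ClaimPath → β} {n : ℕ}
    (hF : DependsOn F (Set.Iic n)) (ω : ClaimPath) :
    F (extendPath n (Preorder.frestrictLe (π := fun _ => ℝ × ℝ) n ω)) = F ω :=
  hF fun _ hk => BonusModel.extendPath_frestrictLe hk ω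

variable {M} {η : Kernel (Fin 2) (ℝ × ℝ)} [IsMarkovKernel η] {i : Fin 2}

/-- One-step Markov property of the path. -/
lemma lintegral_chainLaw_succ {n : ℕ} {G : ClaimPath → ℝ × ℝ → ℝ≥0∞}
    (hG : Measurable (Function.uncurry G)) (hd : ∀ y, DependsOn (fun ω => G ω y) (Set.Iic n)) :
    ∫⁻ ω, G ω (ω (n + 1)) ∂(M.chainLaw η i) =
      ∫⁻ ω, ∫⁻ y, G ω y ∂(η (M.J n ω)) ∂(M.chainLaw η i) := by
  -- The joint law of the history up to n and the next pair is the history's law composed with the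
  -- step kernel; `extendPath` lets `G` be tested against it.
  have key := Kernel.map_frestrictLe_trajMeasure_compProd_eq_map_trajMeasure
    (X := fun _ => ℝ × ℝ) (μ₀ := Measure.dirac (M.startPoint i)) (κ := M.stateStep η) (a := n)
  have hH : Measurable fun p : (Π _ : Finset.Iic n, ℝ × ℝ) × (ℝ × ℝ) =>
      G (extendPath n p.1) p.2 :=
    hG.comp (((measurable_extendPath n).comp measurable_fst).prodMk measurable_snd)
  have h2 := congrArg (fun μ => ∫⁻ p, G (extendPath n p.1) p.2 ∂μ) key
  rw [Measure.lintegral_compProd hH, lintegral_map hH (by fun_prop),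
    lintegral_map hH.lintegral_kernel_prod_right' (by fun_prop)] at h2
  have e : ∀ y ω, G (extendPath n (Preorder.frestrictLe (π := fun _ => ℝ × ℝ) n ω)) y = G ω y :=
    fun y ω => (hd y).extendPath_frestrictLe ω
  simp only [e] at h2
  exact h2.symm

lemma chainLaw_ae_zero : ∀ᵐ ω ∂(M.chainLaw η i), ω 0 = M.startPoint i := by
  have h : (M.chainLaw η i).map (fun ω => ω 0) = Measure.dirac (M.startPoint i) := by
    have e : (fun ω : ClaimPath => ω 0) =
        (fun h : (Π _ : Finset.Iic 0, ℝ × ℝ) => h ⟨0, by simp⟩) ∘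
          Preorder.frestrictLe (π := fun _ => ℝ × ℝ) 0 := rfl
    rw [e, ← Measure.map_map (by fun_prop) (by fun_prop), chainLaw, Kernel.trajMeasure,
      Measure.map_comp _ _ (by fun_prop), Kernel.traj_map_frestrictLe, Kernel.partialTraj_self,
      Measure.id_comp, Measure.map_map (by fun_prop) (by fun_prop)]
    exact Measure.map_dirac' ((measurable_pi_apply _).comp (by fun_prop)) _
  refine ae_of_ae_map (p := fun y : ℝ × ℝ => y = M.startPoint i)
    (measurable_pi_apply (X := fun _ => ℝ × ℝ) 0).aemeasurable ?_
  rw [h]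
  exact (ae_dirac_iff (measurableSet_singleton _)).2 rfl

lemma state_startPoint (i : Fin 2) : M.state (M.startPoint i).1 = i := by
  fin_cases i <;> simp [state, startPoint]

lemma chainLaw_ae_J_zero : ∀ᵐ ω ∂(M.chainLaw η i), M.J 0 ω = i := by
  filter_upwards [chainLaw_ae_zero (M := M) (η := η) (i := i)] with ω h
  rw [J, h, state_startPoint]

variable (M) in
lemma measurable_J (n : ℕ) : Measurable (M.J n) :=
  M.measurable_state.comp (measurable_fst.comp (measurable_pi_apply _))

variable (M) in
lemma dependsOn_J {k n : ℕ} (hk : k ≤ n) : DependsOn (M.J k) (Set.Iic n) := by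
  intro ω ω' h
  simp [J, h k hk]

lemma measurable_S (n : ℕ) : Measurable (S n) := by
  unfold S
  fun_prop

lemma dependsOn_S {k n : ℕ} (hk : k ≤ n) : DependsOn (S k) (Set.Iic n) := by
  intro ω ω' h
  refine Finset.sum_congr rfl fun j hj => ?_
  rw [h j ((Finset.mem_Icc.1 hj).2.trans hk)]

lemma S_zero (ω : ClaimPath) : S 0 ω = 0 := by simp [S]

lemma S_succ (n : ℕ) (ω : ClaimPath) :
    S (n + 1) ω = S n ω + ((ω (n + 1)).2 - (ω (n + 1)).1) :=
  Finset.sum_Icc_succ_top (by omega) _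

/-- One-step Markov property for a product of a functional of the past and one of the next step. -/
lemma lintegral_chainLaw_mul_succ {n : ℕ} {F : ClaimPath → ℝ≥0∞} (hF : Measurable F)
    (hd : DependsOn F (Set.Iic n)) {u : Fin 2 → ℝ × ℝ → ℝ≥0∞} (hu : ∀ j, Measurable (u j)) :
    ∫⁻ ω, F ω * u (M.J n ω) (ω (n + 1)) ∂(M.chainLaw η i) =
      ∫⁻ ω, F ω * ∫⁻ y, u (M.J n ω) y ∂(η (M.J n ω)) ∂(M.chainLaw η i) := by
  have hu' : Measurable (Function.uncurry u) := measurable_from_prod_countable_right hu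
  rw [lintegral_chainLaw_succ (G := fun ω y => F ω * u (M.J n ω) y)]
  · refine lintegral_congr fun ω => ?_
    rw [lintegral_const_mul _ (hu _)]
  · exact (hF.comp measurable_fst).mul
      (hu'.comp (((M.measurable_J n).comp measurable_fst).prodMk measurable_snd))
  · intro y ω ω' h
    simp only [hd h, M.dependsOn_J le_rfl h]

/-- If the one-step weights have mean at most `r`, a functional that grows by at most these weights
has mean at most `r ^ n`. -/
lemma lintegral_chainLaw_le_pow {F : ℕ → ClaimPath → ℝ≥0∞} (hF : ∀ n, Measurable (F n))
    (hd : ∀ n, DependsOn (F n) (Set.Iic n)) {u : Fin 2 → ℝ × ℝ → ℝ≥0∞}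
    (hu : ∀ j, Measurable (u j)) {r : ℝ≥0∞} (hr : ∀ j, ∫⁻ y, u j y ∂(η j) ≤ r)
    (h0 : ∀ ω, F 0 ω ≤ 1) (hs : ∀ n ω, F (n + 1) ω ≤ F n ω * u (M.J n ω) (ω (n + 1))) (n : ℕ) :
    ∫⁻ ω, F n ω ∂(M.chainLaw η i) ≤ r ^ n := by
  induction n with
  | zero => exact (lintegral_mono h0).trans (by simp)
  | succ n ih =>
    calc _ ≤ ∫⁻ ω, F n ω * u (M.J n ω) (ω (n + 1)) ∂(M.chainLaw η i) := lintegral_mono (hs n)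
      _ = ∫⁻ ω, F n ω * ∫⁻ y, u (M.J n ω) y ∂(η (M.J n ω)) ∂(M.chainLaw η i) :=
          lintegral_chainLaw_mul_succ (hF n) (hd n) hu
      _ ≤ ∫⁻ ω, F n ω * r ∂(M.chainLaw η i) := by gcongr; exact hr _
      _ = (∫⁻ ω, F n ω ∂(M.chainLaw η i)) * r := lintegral_mul_const _ (hF n)
      _ ≤ r ^ (n + 1) := by rw [pow_succ]; gcongr

/-- A property that holds almost surely for each single transition holds along the path. -/
lemma chainLaw_ae_succ {p : ℝ × ℝ → Prop} (hp : MeasurableSet {y | p y})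
    (h : ∀ j, ∀ᵐ y ∂(η j), p y) (n : ℕ) : ∀ᵐ ω ∂(M.chainLaw η i), p (ω (n + 1)) := by
  have h1 := lintegral_chainLaw_mul_succ (M := M) (η := η) (i := i) (n := n) (F := fun _ => 1)
    measurable_const ((dependsOn_const _).mono (Set.empty_subset _))
    (u := fun _ => {y | p y}ᶜ.indicator 1) (fun _ => measurable_one.indicator hp.compl)
  have h2 : ∀ j, ∫⁻ y, {y | p y}ᶜ.indicator 1 y ∂(η j) = 0 := fun j => by
    rw [lintegral_indicator_one hp.compl]
    exact h j
  simp only [one_mul, h2, lintegral_zero] at h1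
  have h3 : Measurable fun ω : ClaimPath => {y | p y}ᶜ.indicator (1 : ℝ × ℝ → ℝ≥0∞) (ω (n + 1)) :=
    (measurable_one.indicator hp.compl).comp (measurable_pi_apply _)
  filter_upwards [(lintegral_eq_zero_iff h3).1 h1] with ω hω
  simpa using hω

end BonusModel


/-! ### Exponential moments of exponential distributions -/

lemma expMeasure_eq_withDensity (r : ℝ) :
    expMeasure r = volume.withDensity (exponentialPDF r) := rfl

lemma measurable_exponentialPDF (r : ℝ) : Measurable (exponentialPDF r) :=
  (measurable_exponentialPDFReal r).ennreal_ofReal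

lemma lintegral_expMeasure (r : ℝ) {f : ℝ → ℝ≥0∞} (hf : Measurable f) :
    ∫⁻ y, f y ∂(expMeasure r) = ∫⁻ y, exponentialPDF r y * f y := by
  rw [expMeasure_eq_withDensity,
    lintegral_withDensity_eq_lintegral_mul _ (measurable_exponentialPDF r) hf]
  rfl

lemma measurable_ofReal_exp_mul (θ : ℝ) :
    Measurable fun y : ℝ => ENNReal.ofReal (Real.exp (θ * y)) := by
  fun_prop

/-- Multiplying the Exp(r) density by e^{θy} gives r/(r-θ) times the Exp(r-θ) density. -/
lemma lintegral_exp_mul_expMeasure {r θ : ℝ} (hr : 0 < r) (hθ : θ < r) :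
    ∫⁻ y, ENNReal.ofReal (Real.exp (θ * y)) ∂(expMeasure r) = ENNReal.ofReal (r / (r - θ)) := by
  have hrθ : 0 < r - θ := sub_pos.2 hθ
  rw [lintegral_expMeasure r (measurable_ofReal_exp_mul θ), ← mul_one (ENNReal.ofReal _),
    ← lintegral_exponentialPDF_eq_one hrθ, ← lintegral_const_mul _ (measurable_exponentialPDF _)]
  refine lintegral_congr fun y => ?_
  rw [exponentialPDF_eq, exponentialPDF_eq, ← ENNReal.ofReal_mul (by split_ifs <;> positivity),
    ← ENNReal.ofReal_mul (by positivity)]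
  congr 1
  split_ifs
  · rw [mul_assoc, ← Real.exp_add, ← mul_assoc, div_mul_cancel₀ _ hrθ.ne']
    ring_nf
  · simp

/-- Here the integrand against Lebesgue measure is at least r on the whole half-line. -/
lemma lintegral_exp_mul_expMeasure_eq_top {r θ : ℝ} (hr : 0 < r) (hθ : r ≤ θ) :
    ∫⁻ y, ENNReal.ofReal (Real.exp (θ * y)) ∂(expMeasure r) = ∞ := by
  rw [lintegral_expMeasure r (measurable_ofReal_exp_mul θ), eq_top_iff]
  have h : ∫⁻ _ in Set.Ici (0 : ℝ), ENNReal.ofReal r = ∞ := by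
    rw [setLIntegral_const, Real.volume_Ici, ENNReal.mul_top (by simpa using hr)]
  rw [← h, ← lintegral_indicator measurableSet_Ici]
  refine lintegral_mono fun y => ?_
  by_cases hy : 0 ≤ y
  · rw [Set.indicator_of_mem (Set.mem_Ici.2 hy), exponentialPDF_of_nonneg hy,
      ← ENNReal.ofReal_mul (by positivity), mul_assoc, ← Real.exp_add]
    refine ENNReal.ofReal_le_ofReal (le_mul_of_one_le_right hr.le (Real.one_le_exp ?_))
    nlinarith
  · rw [Set.indicator_of_notMem (by simpa using hy)]
    exact zero_le

lemma ae_expMeasure_pos (r : ℝ) : ∀ᵐ t ∂(expMeasure r), 0 < t := by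
  change expMeasure r {t | 0 < t}ᶜ = 0
  have : {t : ℝ | 0 < t}ᶜ = Set.Iic 0 := by ext; simp
  rw [this, expMeasure_eq_withDensity, withDensity_apply _ measurableSet_Iic,
    setLIntegral_congr Iio_ae_eq_Iic.symm]
  exact lintegral_exponentialPDF_of_nonpos le_rfl

lemma expMeasure_pos_of_Ioo_subset {r a b : ℝ} (hr : 0 < r) (ha : 0 ≤ a) (hab : a < b) {s : Set ℝ}
    (h : Set.Ioo a b ⊆ s) : 0 < expMeasure r s := by
  refine lt_of_lt_of_le ?_ (measure_mono h)
  rw [expMeasure_eq_withDensity, withDensity_apply _ measurableSet_Ioo,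
    setLIntegral_pos_iff (measurable_exponentialPDF r)]
  refine lt_of_lt_of_le ?_ (measure_mono (s := Set.Ioo a b) fun t ht => ⟨?_, ht⟩)
  · simpa using hab
  · have := exponentialPDFReal_pos hr (ha.trans_lt ht.1)
    simpa [exponentialPDF] using this

/-! ### The entries of F̂[κ] as exponential moments of one step -/

namespace BonusModel

variable (M : BonusModel)

lemma claimKernel_apply (i : Fin 2) :
    M.claimKernel i = (expMeasure (M.rate i)).prod (expMeasure M.beta) := rfl

instance (i : Fin 2) : IsProbabilityMeasure (expMeasure (M.rate i)) :=
  isProbabilityMeasure_expMeasure (M.rate_pos i)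

instance : IsProbabilityMeasure (expMeasure M.beta) :=
  isProbabilityMeasure_expMeasure M.beta_pos

/-- Exponential moment of the next increment on the event that the next state is `j`. -/
def tiltMass (κ : ℝ) (i j : Fin 2) : ℝ≥0∞ :=
  ∫⁻ y in {y | M.state y.1 = j}, ENNReal.ofReal (Real.exp (κ * (y.2 - y.1))) ∂(M.claimKernel i)

variable {M}

lemma measurableSet_state (j : Fin 2) : MeasurableSet {t | M.state t = j} :=
  M.measurable_state (measurableSet_singleton j)

lemma measurableSet_state_fst (j : Fin 2) : MeasurableSet {y : ℝ × ℝ | M.state y.1 = j} :=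
  measurable_fst (measurableSet_state j)

lemma lintegral_claimKernel_mul (i : Fin 2) {f g : ℝ → ℝ≥0∞} (hf : Measurable f)
    (hg : Measurable g) : ∫⁻ y, f y.1 * g y.2 ∂(M.claimKernel i) =
      (∫⁻ t, f t ∂(expMeasure (M.rate i))) * ∫⁻ t, g t ∂(expMeasure M.beta) := by
  rw [claimKernel_apply, lintegral_prod_mul hf.aemeasurable hg.aemeasurable]

lemma ofReal_exp_increment (κ : ℝ) (y : ℝ × ℝ) : ENNReal.ofReal (Real.exp (κ * (y.2 - y.1))) =
    ENNReal.ofReal (Real.exp (-κ * y.1)) * ENNReal.ofReal (Real.exp (κ * y.2)) := by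
  rw [← ENNReal.ofReal_mul (Real.exp_nonneg _), ← Real.exp_add]
  ring_nf

/-- Time and claim are independent, and the next state depends on the time alone. -/
lemma tiltMass_eq (κ : ℝ) (i j : Fin 2) : M.tiltMass κ i j =
    (∫⁻ t in {t | M.state t = j}, ENNReal.ofReal (Real.exp (-κ * t)) ∂(expMeasure (M.rate i))) *
      ∫⁻ y, ENNReal.ofReal (Real.exp (κ * y)) ∂(expMeasure M.beta) := by
  rw [← lintegral_indicator (measurableSet_state j), ← lintegral_claimKernel_mul i
    ((measurable_ofReal_exp_mul _).indicator (measurableSet_state j)) (measurable_ofReal_exp_mul _),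
    tiltMass, ← lintegral_indicator (measurableSet_state_fst j)]
  refine lintegral_congr fun y => ?_
  by_cases h : M.state y.1 = j <;> simp [h, ofReal_exp_increment]

lemma kernelMatrix_eq (κ : ℝ) (i j : Fin 2) :
    M.kernelMatrix κ i j = (M.tiltMass κ i j).toReal := by
  have h1 : MeasurableSet {ω : ClaimPath | M.J 1 ω = j} :=
    M.measurable_J 1 (measurableSet_singleton j)
  rw [kernelMatrix, Matrix.of_apply, integral_eq_lintegral_of_nonneg_ae
    (.of_forall fun _ => Real.exp_nonneg _)
    (Measurable.aestronglyMeasurable (by have := measurable_S; fun_prop))]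
  congr 1
  rw [← lintegral_indicator h1, pathLaw_eq_chainLaw]
  set u : ℝ × ℝ → ℝ≥0∞ := {y : ℝ × ℝ | M.state y.1 = j}.indicator
    fun y => ENNReal.ofReal (Real.exp (κ * (y.2 - y.1))) with hu
  have hum : Measurable u := Measurable.indicator (by fun_prop) (measurableSet_state_fst j)
  have h2 := lintegral_chainLaw_mul_succ (M := M) (η := M.claimKernel) (i := i) (n := 0)
    (F := fun _ => 1) measurable_const ((dependsOn_const _).mono (Set.empty_subset _))
    (u := fun _ => u) (fun _ => hum)
  simp only [one_mul] at h2
  have h3 : ∫⁻ ω, ∫⁻ y, u y ∂(M.claimKernel (M.J 0 ω)) ∂(M.chainLaw M.claimKernel i) =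
      ∫⁻ _, ∫⁻ y, u y ∂(M.claimKernel i) ∂(M.chainLaw M.claimKernel i) := by
    refine lintegral_congr_ae ?_
    filter_upwards [chainLaw_ae_J_zero (M := M) (η := M.claimKernel) (i := i)] with ω h
    rw [h]
  rw [h3, lintegral_const, measure_univ, mul_one, hu,
    lintegral_indicator (measurableSet_state_fst j)] at h2
  rw [tiltMass, ← h2]
  refine lintegral_congr fun ω => ?_
  simp [S, Set.indicator_apply, J]

/-- For κ ≥ β every moment is infinite, so the Bochner integrals defining the matrix take their
default value 0, and a zero matrix fixes no nonzero vector. -/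
lemma lt_beta_of_eigenvector {κ : ℝ} {v : Fin 2 → ℝ} (hv : v ≠ 0)
    (hev : M.kernelMatrix κ *ᵥ v = v) : κ < M.beta := by
  by_contra! h
  refine hv ?_
  rw [← hev]
  have : M.kernelMatrix κ = 0 := by
    ext i j
    rw [kernelMatrix_eq, tiltMass_eq, lintegral_exp_mul_expMeasure_eq_top M.beta_pos h]
    simp
  rw [this, Matrix.zero_mulVec]

lemma tiltMass_ne_top {κ : ℝ} (hκ : 0 < κ) (hb : κ < M.beta) (i j : Fin 2) :
    M.tiltMass κ i j ≠ ∞ := by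
  rw [tiltMass_eq, lintegral_exp_mul_expMeasure M.beta_pos hb]
  refine ENNReal.mul_ne_top (ne_top_of_le_ne_top ?_ (setLIntegral_le_lintegral _ _))
    ENNReal.ofReal_ne_top
  rw [lintegral_exp_mul_expMeasure (M.rate_pos i) (by linarith [M.rate_pos i])]
  exact ENNReal.ofReal_ne_top

lemma tiltMass_pos (κ : ℝ) (i j : Fin 2) : 0 < M.tiltMass κ i j := by
  have hpos : ∀ j, 0 < expMeasure (M.rate i) {t | M.state t = j} := by
    intro j
    fin_cases j
    · refine expMeasure_pos_of_Ioo_subset (M.rate_pos i) le_rfl M.xi_pos fun t ht => ?_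
      simp [state, ht.2.le]
    · refine expMeasure_pos_of_Ioo_subset (M.rate_pos i) M.xi_pos.le (lt_add_one M.xi)
        fun t ht => ?_
      simp [state, ht.1]
  have hsupp : ∀ θ : ℝ, (Function.support fun t => ENNReal.ofReal (Real.exp (θ * t))) =
      Set.univ := fun θ => by
    ext t
    simp [Real.exp_pos]
  rw [tiltMass_eq]
  refine ENNReal.mul_pos (ne_of_gt ?_) (ne_of_gt ?_)
  · rw [setLIntegral_pos_iff (measurable_ofReal_exp_mul _), hsupp, Set.univ_inter]
    exact hpos j
  · rw [lintegral_pos_iff_support (measurable_ofReal_exp_mul _), hsupp]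
    simp

end BonusModel


/-! ### Cycles between visits to state 2 and the sign of the eigenvector -/

namespace BonusModel

variable (M : BonusModel)

/-- The first `n` claims all fall into state 1. -/
def stayShort (n : ℕ) : Set ClaimPath := {ω | ∀ k, 1 ≤ k → k ≤ n → M.J k ω = 0}

variable {M}

lemma measurableSet_stayShort (n : ℕ) : MeasurableSet (M.stayShort n) := by
  simp only [stayShort, Set.ofPred_forall]
  exact .iInter fun k => .iInter fun _ => .iInter fun _ =>
    M.measurable_J k (measurableSet_singleton 0)

lemma stayShort_zero : M.stayShort 0 = Set.univ := by
  ext ω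
  simp only [stayShort, Set.mem_ofPred_eq, Set.mem_univ, iff_true]
  omega

lemma mem_stayShort_succ {n : ℕ} {ω : ClaimPath} :
    ω ∈ M.stayShort (n + 1) ↔ ω ∈ M.stayShort n ∧ M.J (n + 1) ω = 0 := by
  refine ⟨fun h => ⟨fun k h1 h2 => h k h1 (by omega), h _ (by omega) le_rfl⟩, fun h k h1 h2 => ?_⟩
  rcases Nat.le_succ_iff.1 h2 with h3 | rfl
  exacts [h.1 k h1 h3, h.2]

lemma dependsOn_stayShort (n : ℕ) : DependsOn (· ∈ M.stayShort n) (Set.Iic n) := by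
  intro ω ω' h
  simp only [stayShort, Set.mem_ofPred_eq, eq_iff_iff]
  refine forall_congr' fun k => forall_congr' fun _ => forall_congr' fun hk => ?_
  rw [M.dependsOn_J hk h]

/-- Exponential moment of `S` over a stay in state 1 followed by a claim in state `j`. -/
lemma lintegral_stayShort (κ : ℝ) (n : ℕ) (j i : Fin 2) :
    ∫⁻ ω in M.stayShort n ∩ {ω | M.J (n + 1) ω = j},
        ENNReal.ofReal (Real.exp (κ * S (n + 1) ω)) ∂(M.pathLaw i) =
      ∫⁻ ω in M.stayShort n, ENNReal.ofReal (Real.exp (κ * S n ω)) * M.tiltMass κ (M.J n ω) j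
        ∂(M.pathLaw i) := by
  have hm : ∀ n, Measurable fun ω : ClaimPath => ENNReal.ofReal (Real.exp (κ * S n ω)) := fun n => by
    have := measurable_S n
    fun_prop
  have h := lintegral_chainLaw_mul_succ (M := M) (η := M.claimKernel) (i := i) (n := n)
    (F := (M.stayShort n).indicator fun ω => ENNReal.ofReal (Real.exp (κ * S n ω)))
    ((hm n).indicator (measurableSet_stayShort n))
    (fun ω ω' h => by
      have h1 : ω ∈ M.stayShort n ↔ ω' ∈ M.stayShort n := iff_of_eq (dependsOn_stayShort n h)
      by_cases h2 : ω' ∈ M.stayShort n <;> simp [h1, h2, dependsOn_S le_rfl h])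
    (u := fun _ => {y : ℝ × ℝ | M.state y.1 = j}.indicator
      fun y => ENNReal.ofReal (Real.exp (κ * (y.2 - y.1))))
    (fun _ => Measurable.indicator (by fun_prop) (measurableSet_state_fst j))
  have hJ : MeasurableSet {ω : ClaimPath | M.J (n + 1) ω = j} :=
    M.measurable_J (n + 1) (measurableSet_singleton j)
  rw [← lintegral_indicator ((measurableSet_stayShort n).inter hJ),
    ← lintegral_indicator (measurableSet_stayShort n), pathLaw_eq_chainLaw]
  calc _ = _ := lintegral_congr fun ω => ?_
    _ = _ := h
    _ = _ := lintegral_congr fun ω => ?_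
  · by_cases h1 : ω ∈ M.stayShort n <;> by_cases h2 : M.J (n + 1) ω = j <;>
      have h3 := h2 <;> simp only [J] at h3 <;> simp [h1, h2, h3]
    rw [← ENNReal.ofReal_mul (Real.exp_nonneg _), ← Real.exp_add, S_succ]
    ring_nf
  · rw [lintegral_indicator (measurableSet_state_fst j)]
    by_cases h1 : ω ∈ M.stayShort n <;> simp [h1, tiltMass]

/-- Entering state 1 contributes the left-hand side; each further step there multiplies by a factor
that is at least 1, so nothing is lost. -/
lemma tiltMass_le_lintegral_stayShort {κ : ℝ} (h00 : 1 ≤ M.tiltMass κ 0 0) (i : Fin 2) (n : ℕ) :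
    M.tiltMass κ i 0 ≤ ∫⁻ ω in M.stayShort (n + 1), ENNReal.ofReal (Real.exp (κ * S (n + 1) ω))
      ∂(M.pathLaw i) := by
  have e : ∀ n, M.stayShort (n + 1) = M.stayShort n ∩ {ω | M.J (n + 1) ω = 0} := fun n => by
    ext ω
    exact mem_stayShort_succ
  induction n with
  | zero =>
    rw [e, lintegral_stayShort, stayShort_zero, Measure.restrict_univ]
    have : ∀ᵐ ω ∂(M.pathLaw i), ENNReal.ofReal (Real.exp (κ * S 0 ω)) * M.tiltMass κ (M.J 0 ω) 0
        = M.tiltMass κ i 0 := by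
      rw [pathLaw_eq_chainLaw]
      filter_upwards [chainLaw_ae_J_zero (M := M) (η := M.claimKernel) (i := i)] with ω hω
      simp [S_zero, hω]
    rw [lintegral_congr_ae this]
    simp
  | succ n ih =>
    rw [e, lintegral_stayShort]
    refine ih.trans (setLIntegral_mono' (measurableSet_stayShort _) fun ω hω => ?_)
    rw [(mem_stayShort_succ.1 hω).2]
    exact le_mul_of_one_le_right' h00

lemma cycleIncrement_eq {n : ℕ} {ω : ClaimPath} (h : ω ∈ M.stayShort n)
    (hJ : M.J (n + 1) ω = 1) : M.cycleIncrement ω = S (n + 1) ω := by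
  have : sInf {n : ℕ | 1 ≤ n ∧ M.J n ω = 1} = n + 1 := by
    refine le_antisymm (Nat.sInf_le ⟨by omega, hJ⟩)
      (le_csInf ⟨n + 1, by omega, hJ⟩ fun k hk => ?_)
    by_contra! hlt
    simpa [h k hk.1 (by omega)] using hk.2
  rw [cycleIncrement, this]

/-- The stay in state 1 has a subcritical exponential moment as soon as `X_1` has a finite one. -/
lemma tiltMass_zero_zero_lt_one {κ : ℝ} (hκ : M.IsAdjustmentCoefficient κ) :
    M.tiltMass κ 0 0 < 1 := by
  by_contra! h00
  have hint : Integrable (fun ω => Real.exp (κ * M.cycleIncrement ω)) (M.pathLaw 1) := by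
    by_contra hni
    have := hκ.2
    rw [mgf, integral_undef hni] at this
    exact zero_ne_one this
  have hfin : ∫⁻ ω, ENNReal.ofReal (Real.exp (κ * M.cycleIncrement ω)) ∂(M.pathLaw 1) ≠ ∞ := by
    have := hint.lintegral_lt_top
    exact this.ne
  -- `V n` is the event that the cycle has length n + 1. These events are disjoint, so their
  -- contributions to E[e^{κX_1}] are summable and tend to zero, against the uniform lower bound
  -- `hlow`.
  set V : ℕ → Set ClaimPath := fun n => M.stayShort n ∩ {ω | M.J (n + 1) ω = 1} with hV
  have hVm : ∀ n, MeasurableSet (V n) := fun n =>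
    (measurableSet_stayShort n).inter (M.measurable_J (n + 1) (measurableSet_singleton 1))
  have hVd : Pairwise (Function.onFun Disjoint V) := by
    refine (pairwise_disjoint_on V).2 fun m n hmn => Set.disjoint_left.2 fun ω h1 h2 => ?_
    have h3 : M.J (m + 1) ω = 1 := h1.2
    rw [h2.1 (m + 1) (by omega) (by omega)] at h3
    exact absurd h3 (by decide)
  have hsum : ∑' n, ∫⁻ ω in V n, ENNReal.ofReal (Real.exp (κ * M.cycleIncrement ω)) ∂(M.pathLaw 1)
      ≠ ∞ := by
    rw [← lintegral_iUnion hVm hVd]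
    exact ne_top_of_le_ne_top hfin (setLIntegral_le_lintegral _ _)
  -- The shift to `V (n + 1)` forces at least one claim in state 1, so the last transition of the
  -- cycle is from state 1 to state 2.
  have hlow : ∀ n, M.tiltMass κ 1 0 * M.tiltMass κ 0 1 ≤
      ∫⁻ ω in V (n + 1), ENNReal.ofReal (Real.exp (κ * M.cycleIncrement ω)) ∂(M.pathLaw 1) := by
    intro n
    rw [setLIntegral_congr_fun (hVm _) (g := fun ω => ENNReal.ofReal (Real.exp (κ * S (n + 1 + 1) ω)))
      fun ω hω => by simp only [cycleIncrement_eq hω.1 hω.2], hV, lintegral_stayShort,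
      setLIntegral_congr_fun (measurableSet_stayShort _) (g := fun ω =>
        ENNReal.ofReal (Real.exp (κ * S (n + 1) ω)) * M.tiltMass κ 0 1)
      fun ω hω => by simp only [(mem_stayShort_succ.1 hω).2], lintegral_mul_const _
      (by have := measurable_S (n + 1); fun_prop)]
    gcongr
    exact tiltMass_le_lintegral_stayShort h00 1 n
  have htend := (ENNReal.tendsto_atTop_zero_of_tsum_ne_top hsum).comp (Filter.tendsto_add_atTop_nat 1)
  have h0 := ge_of_tendsto' htend hlow
  exact absurd h0 (not_le.2 (ENNReal.mul_pos (tiltMass_pos κ 1 0).ne' (tiltMass_pos κ 0 1).ne'))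

/-- The eigenvector of the matrix `F̂[κ]` has entries of one sign. -/
lemma eigenvector_div_pos {κ : ℝ} (hκ : M.IsAdjustmentCoefficient κ) {v : Fin 2 → ℝ} (hv : v ≠ 0)
    (hev : M.kernelMatrix κ *ᵥ v = v) (i j : Fin 2) : 0 < v i / v j := by
  have hb := lt_beta_of_eigenvector hv hev
  have h00 : M.kernelMatrix κ 0 0 < 1 := by
    rw [kernelMatrix_eq, ← ENNReal.toReal_one]
    exact (ENNReal.toReal_lt_toReal (tiltMass_ne_top hκ.1 hb 0 0) ENNReal.one_ne_top).2
      (tiltMass_zero_zero_lt_one hκ)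
  have h01 : 0 < M.kernelMatrix κ 0 1 := by
    rw [kernelMatrix_eq]
    exact ENNReal.toReal_pos (tiltMass_pos κ 0 1).ne' (tiltMass_ne_top hκ.1 hb 0 1)
  have h := congrFun hev 0
  simp only [Matrix.mulVec, dotProduct, Fin.sum_univ_two] at h
  have h1 : (1 - M.kernelMatrix κ 0 0) * v 0 = M.kernelMatrix κ 0 1 * v 1 := by linarith
  have hc : 0 < 1 - M.kernelMatrix κ 0 0 := by linarith
  have hv0 : v 0 = M.kernelMatrix κ 0 1 / (1 - M.kernelMatrix κ 0 0) * v 1 := by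
    field_simp
    linarith
  set c := M.kernelMatrix κ 0 1 / (1 - M.kernelMatrix κ 0 0)
  have hcpos : 0 < c := by positivity
  -- Both entries are positive multiples of `v 1`, whose own sign is free; hence only ratios are
  -- claimed to be positive.
  have hv1 : v 1 ≠ 0 := fun h1 => hv (by ext i; fin_cases i <;> simp [hv0, h1])
  have hd : ∀ i, ∃ d : ℝ, 0 < d ∧ v i = d * v 1 := by
    intro i
    fin_cases i
    exacts [⟨c, hcpos, hv0⟩, ⟨1, one_pos, (one_mul _).symm⟩]
  obtain ⟨a, ha, hai⟩ := hd i
  obtain ⟨b, hb', hbj⟩ := hd j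
  rw [hai, hbj, mul_div_mul_right _ _ hv1]
  positivity

end BonusModel


/-! ### The tilted path law: existence and uniqueness -/

namespace BonusModel

variable (M : BonusModel)

/-- Factor by which the likelihood ratio changes in one step. -/
def stepRatio (κ : ℝ) (v : Fin 2 → ℝ) (i : Fin 2) (y : ℝ × ℝ) : ℝ :=
  Real.exp (κ * (y.2 - y.1)) * (v (M.state y.1) / v i)

lemma measurable_stepRatio (κ : ℝ) (v : Fin 2 → ℝ) (i : Fin 2) : Measurable (M.stepRatio κ v i) := by
  have h1 : Measurable fun y : ℝ × ℝ => v (M.state y.1) :=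
    (measurable_from_top (f := v)).comp (M.measurable_state.comp measurable_fst)
  exact Measurable.mul (by fun_prop) (h1.div_const _)

/-- One-step kernel of the tilted path. -/
def tiltedKernel (κ : ℝ) (v : Fin 2 → ℝ) : Kernel (Fin 2) (ℝ × ℝ) :=
  Kernel.ofFunOfCountable fun i =>
    (M.claimKernel i).withDensity fun y => ENNReal.ofReal (M.stepRatio κ v i y)

lemma tiltedKernel_apply (κ : ℝ) (v : Fin 2 → ℝ) (i : Fin 2) : M.tiltedKernel κ v i =
    (M.claimKernel i).withDensity fun y => ENNReal.ofReal (M.stepRatio κ v i y) := rfl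

variable {M} {κ : ℝ} {v : Fin 2 → ℝ}

lemma lintegral_tiltedKernel (i : Fin 2) {f : ℝ × ℝ → ℝ≥0∞} (hf : Measurable f) :
    ∫⁻ y, f y ∂(M.tiltedKernel κ v i) =
      ∫⁻ y, ENNReal.ofReal (M.stepRatio κ v i y) * f y ∂(M.claimKernel i) := by
  rw [tiltedKernel_apply, lintegral_withDensity_eq_lintegral_mul _
    (M.measurable_stepRatio κ v i).ennreal_ofReal hf]
  rfl

/-- This is row i of the eigenvector equation divided by `v i`, after splitting the integral
according to the next state. -/
lemma lintegral_stepRatio (hκ : 0 < κ) (hb : κ < M.beta) (hpos : ∀ i j, 0 < v i / v j)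
    (hev : M.kernelMatrix κ *ᵥ v = v) (i : Fin 2) :
    ∫⁻ y, ENNReal.ofReal (M.stepRatio κ v i y) ∂(M.claimKernel i) = 1 := by
  have hexp : Measurable fun y : ℝ × ℝ => ENNReal.ofReal (Real.exp (κ * (y.2 - y.1))) := by fun_prop
  have h1 : ∀ y : ℝ × ℝ, ENNReal.ofReal (M.stepRatio κ v i y) =
      ∑ j, {y : ℝ × ℝ | M.state y.1 = j}.indicator
        (fun y => ENNReal.ofReal (Real.exp (κ * (y.2 - y.1)))) y * ENNReal.ofReal (v j / v i) := by
    intro y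
    rw [Finset.sum_eq_single_of_mem (M.state y.1) (Finset.mem_univ _)]
    · rw [Set.indicator_of_mem (by rfl), ← ENNReal.ofReal_mul (Real.exp_nonneg _)]
      rfl
    · intro j _ hj
      simp [hj.symm]
  have h2 : ∀ j, ∫⁻ y, {y : ℝ × ℝ | M.state y.1 = j}.indicator
        (fun y => ENNReal.ofReal (Real.exp (κ * (y.2 - y.1)))) y * ENNReal.ofReal (v j / v i)
        ∂(M.claimKernel i) = ENNReal.ofReal (M.kernelMatrix κ i j * (v j / v i)) := by
    intro j
    rw [lintegral_mul_const _ (hexp.indicator (measurableSet_state_fst j)),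
      lintegral_indicator (measurableSet_state_fst j), kernelMatrix_eq,
      ENNReal.ofReal_mul ENNReal.toReal_nonneg, ENNReal.ofReal_toReal (tiltMass_ne_top hκ hb i j)]
    rfl
  have hvi : v i ≠ 0 := fun h => by simpa [h] using hpos i i
  have hev' := congrFun hev i
  rw [Matrix.mulVec, dotProduct] at hev'
  simp_rw [h1]
  rw [lintegral_finsetSum _ fun j _ =>
    (hexp.indicator (measurableSet_state_fst j)).mul_const _]
  simp_rw [h2]
  rw [← ENNReal.ofReal_sum_of_nonneg fun j _ => mul_nonneg
    (by rw [kernelMatrix_eq]; exact ENNReal.toReal_nonneg) (hpos j i).le]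
  simp_rw [← mul_div_assoc]
  rw [← Finset.sum_div, hev', div_self hvi, ENNReal.ofReal_one]

lemma isMarkovKernel_tiltedKernel (hκ : 0 < κ) (hb : κ < M.beta) (hpos : ∀ i j, 0 < v i / v j)
    (hev : M.kernelMatrix κ *ᵥ v = v) : IsMarkovKernel (M.tiltedKernel κ v) := by
  refine ⟨fun i => ⟨?_⟩⟩
  have h := lintegral_tiltedKernel (M := M) (κ := κ) (v := v) i (measurable_const (a := (1 : ℝ≥0∞)))
  simp only [mul_one, lintegral_one] at h
  rw [h, lintegral_stepRatio hκ hb hpos hev]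

variable (M κ v) in
lemma measurable_likelihood (n : ℕ) : Measurable (M.likelihood κ v n) := by
  have h1 : ∀ n, Measurable fun ω : ClaimPath => v (M.J n ω) := fun n =>
    (measurable_from_top (f := v)).comp (M.measurable_J n)
  exact ((measurable_S n).const_mul κ).exp.mul ((h1 n).div (h1 0))

variable (M κ v) in
lemma dependsOn_likelihood (n : ℕ) : DependsOn (M.likelihood κ v n) (Set.Iic n) := by
  intro ω ω' h
  simp only [likelihood, dependsOn_S le_rfl h, M.dependsOn_J le_rfl h,
    M.dependsOn_J (Nat.zero_le n) h]

lemma likelihood_zero (hpos : ∀ i j, 0 < v i / v j) (ω : ClaimPath) :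
    M.likelihood κ v 0 ω = 1 := by
  have hvi : v (M.J 0 ω) ≠ 0 := fun h => by simpa [h] using hpos (M.J 0 ω) (M.J 0 ω)
  simp [likelihood, S_zero, div_self hvi]

lemma likelihood_succ (hpos : ∀ i j, 0 < v i / v j) (n : ℕ) (ω : ClaimPath) :
    M.likelihood κ v (n + 1) ω =
      M.likelihood κ v n ω * M.stepRatio κ v (M.J n ω) (ω (n + 1)) := by
  have hvi : v (M.J n ω) ≠ 0 := fun h => by simpa [h] using hpos (M.J n ω) (M.J n ω)
  have e : M.state (ω (n + 1)).1 = M.J (n + 1) ω := rfl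
  simp only [likelihood, stepRatio, S_succ, mul_add, Real.exp_add, e]
  field_simp

lemma likelihood_pos (hpos : ∀ i j, 0 < v i / v j) (n : ℕ) (ω : ClaimPath) :
    0 < M.likelihood κ v n ω := mul_pos (Real.exp_pos _) (hpos _ _)

/-- Change of measure for functionals of the first `n` claims. -/
lemma lintegral_chainLaw_tiltedKernel [IsMarkovKernel (M.tiltedKernel κ v)]
    (hpos : ∀ i j, 0 < v i / v j) (i : Fin 2) (n : ℕ) {F : ClaimPath → ℝ≥0∞} (hF : Measurable F)
    (hd : DependsOn F (Set.Iic n)) :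
    ∫⁻ ω, F ω ∂(M.chainLaw (M.tiltedKernel κ v) i) =
      ∫⁻ ω, F ω * ENNReal.ofReal (M.likelihood κ v n ω) ∂(M.pathLaw i) := by
  induction n generalizing F with
  | zero =>
    -- At time 0 both laws sit at the same start point, where `F` is constant.
    obtain ⟨c, hc⟩ : ∃ c, ∀ ω : ClaimPath, ω 0 = M.startPoint i → F ω = c :=
      ⟨F fun _ => M.startPoint i, fun ω h => hd fun k hk => by
        rw [Set.mem_Iic, Nat.le_zero] at hk
        rw [hk, h]⟩
    have h1 : ∀ (η : Kernel (Fin 2) (ℝ × ℝ)) [IsMarkovKernel η],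
        ∫⁻ ω, F ω ∂(M.chainLaw η i) = c := by
      intro η _
      have : ∀ᵐ ω ∂(M.chainLaw η i), F ω = c := by
        filter_upwards [chainLaw_ae_zero (M := M) (η := η) (i := i)] with ω h using hc ω h
      rw [lintegral_congr_ae this]
      simp
    simp only [likelihood_zero hpos, ENNReal.ofReal_one, mul_one]
    rw [h1, pathLaw_eq_chainLaw, h1]
  | succ n ih =>
    -- Overwriting coordinate n + 1 separates the past from the last step. `H` below integrates that
    -- step out under the tilted kernel, so the induction hypothesis applies to it; unfolding the
    -- kernel's density and using the Markov property of P backwards restores the step.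
    set G : ClaimPath → ℝ × ℝ → ℝ≥0∞ := fun ω y => F (Function.update ω (n + 1) y) with hG
    have hGF : ∀ ω, F ω = G ω (ω (n + 1)) := fun ω => by simp only [hG, Function.update_eq_self]
    have hup : Measurable fun p : ClaimPath × (ℝ × ℝ) => Function.update p.1 (n + 1) p.2 :=
      measurable_update'
    have hGm : Measurable (Function.uncurry G) := hF.comp hup
    have hGd : ∀ y, DependsOn (fun ω => G ω y) (Set.Iic n) := by
      intro y ω ω' h
      refine hd fun k hk => ?_
      by_cases hkn : k = n + 1
      · subst hkn; simp
      · simp only [Function.update_of_ne hkn]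
        exact h k (by simp only [Set.mem_Iic] at hk ⊢; omega)
    have hw : Measurable (Function.uncurry fun (j : Fin 2) y =>
        ENNReal.ofReal (M.stepRatio κ v j y)) :=
      measurable_from_prod_countable_right fun j => (M.measurable_stepRatio κ v j).ennreal_ofReal
    have hw' : Measurable fun p : ClaimPath × (ℝ × ℝ) =>
        ENNReal.ofReal (M.stepRatio κ v (M.J n p.1) p.2) :=
      hw.comp (((M.measurable_J n).comp measurable_fst).prodMk measurable_snd)
    have hL : Measurable fun ω => ENNReal.ofReal (M.likelihood κ v n ω) :=
      (M.measurable_likelihood κ v n).ennreal_ofReal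
    have hGy : ∀ ω, Measurable (G ω) := fun ω => hGm.comp measurable_prodMk_left
    set H : ClaimPath → ℝ≥0∞ := fun ω => ∫⁻ y, G ω y ∂(M.tiltedKernel κ v (M.J n ω)) with hH
    have hHm : Measurable H := by
      have : H = fun ω => ∫⁻ y, G ω y ∂(((M.tiltedKernel κ v).comap _ (M.measurable_J n)) ω) := rfl
      rw [this]
      exact hGm.lintegral_kernel_prod_right'
    have hHd : DependsOn H (Set.Iic n) := by
      intro ω ω' h
      have h1 : G ω = G ω' := funext fun y => hGd y h
      simp only [hH, h1, M.dependsOn_J le_rfl h]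
    calc ∫⁻ ω, F ω ∂(M.chainLaw (M.tiltedKernel κ v) i)
        = ∫⁻ ω, G ω (ω (n + 1)) ∂(M.chainLaw (M.tiltedKernel κ v) i) := by simp only [← hGF]
      _ = ∫⁻ ω, H ω ∂(M.chainLaw (M.tiltedKernel κ v) i) := lintegral_chainLaw_succ hGm hGd
      _ = ∫⁻ ω, H ω * ENNReal.ofReal (M.likelihood κ v n ω) ∂(M.pathLaw i) := ih hHm hHd
      _ = ∫⁻ ω, ∫⁻ y, ENNReal.ofReal (M.stepRatio κ v (M.J n ω) y) * G ω y *
            ENNReal.ofReal (M.likelihood κ v n ω) ∂(M.claimKernel (M.J n ω)) ∂(M.pathLaw i) := by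
          refine lintegral_congr fun ω => ?_
          simp only [hH, lintegral_tiltedKernel _ (hGy ω)]
          exact (lintegral_mul_const _
            ((M.measurable_stepRatio κ v (M.J n ω)).ennreal_ofReal.mul (hGy ω))).symm
      _ = ∫⁻ ω, ENNReal.ofReal (M.stepRatio κ v (M.J n ω) (ω (n + 1))) * G ω (ω (n + 1)) *
            ENNReal.ofReal (M.likelihood κ v n ω) ∂(M.pathLaw i) := by
          rw [pathLaw_eq_chainLaw]
          refine (lintegral_chainLaw_succ (G := fun ω y =>
            ENNReal.ofReal (M.stepRatio κ v (M.J n ω) y) * G ω y *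
              ENNReal.ofReal (M.likelihood κ v n ω)) ?_ ?_).symm
          · exact (hw'.mul hGm).mul (hL.comp measurable_fst)
          · intro y ω ω' h
            simp only [M.dependsOn_J le_rfl h, M.dependsOn_likelihood κ v n h, hGd y h]
      _ = ∫⁻ ω, F ω * ENNReal.ofReal (M.likelihood κ v (n + 1) ω) ∂(M.pathLaw i) := by
          refine lintegral_congr fun ω => ?_
          rw [← hGF, likelihood_succ hpos, ENNReal.ofReal_mul (likelihood_pos hpos n ω).le]
          ring

lemma exists_dependsOn_of_measurableSet_piLE {n : ℕ} {A : Set ClaimPath}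
    (hA : MeasurableSet[Filtration.piLE (X := fun _ : ℕ => ℝ × ℝ) n] A) :
    MeasurableSet A ∧ DependsOn (· ∈ A) (Set.Iic n) := by
  refine ⟨(Filtration.piLE (X := fun _ : ℕ => ℝ × ℝ)).le n A hA, ?_⟩
  obtain ⟨B, -, rfl⟩ := hA
  intro ω ω' h
  have : Preorder.restrictLe (π := fun _ => ℝ × ℝ) n ω = Preorder.restrictLe n ω' :=
    funext fun k => h k k.2
  simp only [Set.mem_preimage, this]

lemma isTiltedLaw_chainLaw [IsMarkovKernel (M.tiltedKernel κ v)]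
    (hpos : ∀ i j, 0 < v i / v j) (i : Fin 2) :
    M.IsTiltedLaw κ v i (M.chainLaw (M.tiltedKernel κ v) i) := by
  refine ⟨inferInstance, fun n A hA => ?_⟩
  obtain ⟨hAm, hAd⟩ := exists_dependsOn_of_measurableSet_piLE hA
  rw [← lintegral_indicator_one hAm, lintegral_chainLaw_tiltedKernel hpos i n
    (measurable_one.indicator hAm), ← lintegral_indicator hAm]
  · refine lintegral_congr fun ω => ?_
    by_cases h : ω ∈ A <;> simp [h]
  · intro ω ω' h
    have h1 : ω ∈ A ↔ ω' ∈ A := iff_of_eq (hAd h)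
    by_cases h2 : ω' ∈ A <;> simp [h1, h2]

lemma measurableSet_piLE_cylinder {s : Finset ℕ} {B : Set (Π _ : s, ℝ × ℝ)} (hB : MeasurableSet B) :
    MeasurableSet[Filtration.piLE (X := fun _ : ℕ => ℝ × ℝ) (s.sup id)]
      (cylinder (α := fun _ : ℕ => ℝ × ℝ) s B) := by
  refine ⟨(fun (h : Π _ : Set.Iic (s.sup id), ℝ × ℝ) (k : s) =>
    h ⟨k, Finset.le_sup (f := id) k.2⟩) ⁻¹' B, ?_, rfl⟩
  exact measurableSet_preimage (by fun_prop) hB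

/-- Each cylinder involves finitely many coordinates, so its mass is prescribed by the density at
the largest of them; cylinders form a generating π-system. -/
lemma IsTiltedLaw.unique {i : Fin 2} {Q Q' : Measure ClaimPath} (hQ : M.IsTiltedLaw κ v i Q)
    (hQ' : M.IsTiltedLaw κ v i Q') : Q' = Q := by
  have := hQ.isProbabilityMeasure
  have := hQ'.isProbabilityMeasure
  refine ext_of_generate_finite _ (generateFrom_measurableCylinders (α := fun _ : ℕ => ℝ × ℝ)).symm
    isPiSystem_measurableCylinders (fun A hA => ?_) (by simp)
  obtain ⟨s, B, hB, rfl⟩ := (mem_measurableCylinders A).1 hA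
  rw [hQ.density _ _ (measurableSet_piLE_cylinder hB),
    hQ'.density _ _ (measurableSet_piLE_cylinder hB)]

end BonusModel


namespace BonusModel

variable {M : BonusModel} {κ : ℝ} {v : Fin 2 → ℝ}

/-! ### The likelihood ratio vanishes in the limit -/

/-- Bound for the mean of the square root of the one-step likelihood ratio. -/
def sqrtRate (M : BonusModel) (κ : ℝ) : ℝ :=
  (√(M.beta / (M.beta - κ)))⁻¹ * (M.beta / (M.beta - κ / 2))

/-- Strict Cauchy–Schwarz for e^{κY/2}: it amounts to β(β-κ) < (β-κ/2)², where the gap is κ²/4. -/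
lemma sqrtRate_lt_one (hκ : 0 < κ) (hb : κ < M.beta) : sqrtRate M κ < 1 := by
  have hβ := M.beta_pos
  have h1 : 0 < M.beta - κ := by linarith
  have h2 : 0 < M.beta - κ / 2 := by linarith
  rw [sqrtRate, inv_mul_lt_one₀ (by positivity)]
  refine Real.lt_sqrt_of_sq_lt ?_
  rw [div_pow, div_lt_div_iff₀ (by positivity) h1]
  nlinarith [mul_pos hβ (mul_pos hκ hκ)]

/-- The ratio factors as g(τ)e^{κY}. With m = E[e^{κY}], normalization gives E[g(τ)] = 1/m, so
E[√g(τ)] ≤ 1/√m, while the claim contributes E[e^{κY/2}]. -/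
lemma lintegral_sqrt_stepRatio_le (hκ : 0 < κ) (hb : κ < M.beta) (hpos : ∀ i j, 0 < v i / v j)
    (hev : M.kernelMatrix κ *ᵥ v = v) (i : Fin 2) :
    ∫⁻ y, ENNReal.ofReal (√(M.stepRatio κ v i y)) ∂(M.claimKernel i) ≤
      ENNReal.ofReal (sqrtRate M κ) := by
  have hβ := M.beta_pos
  have h1 : 0 < M.beta - κ := by linarith
  have h2 : 0 < M.beta - κ / 2 := by linarith
  set m := M.beta / (M.beta - κ) with hm
  have hm0 : 0 < m := by positivity
  set g : ℝ → ℝ := fun t => Real.exp (-κ * t) * (v (M.state t) / v i) with hg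
  have hgm : Measurable g := by
    have h1 : Measurable fun t => v (M.state t) :=
      (measurable_from_top (f := v)).comp M.measurable_state
    exact Measurable.mul (by fun_prop) (h1.div_const _)
  have hg0 : ∀ t, 0 ≤ g t := fun t => mul_nonneg (Real.exp_nonneg _) (hpos _ _).le
  have hsplit : ∀ y : ℝ × ℝ, M.stepRatio κ v i y = g y.1 * Real.exp (κ * y.2) := fun y => by
    have : κ * (y.2 - y.1) = -κ * y.1 + κ * y.2 := by ring
    rw [stepRatio, hg, this, Real.exp_add]
    ring
  have hgint : (∫⁻ t, ENNReal.ofReal (g t) ∂(expMeasure (M.rate i))) * ENNReal.ofReal m = 1 := by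
    rw [← lintegral_exp_mul_expMeasure hβ hb, ← lintegral_claimKernel_mul i hgm.ennreal_ofReal
      (measurable_ofReal_exp_mul κ), ← lintegral_stepRatio hκ hb hpos hev i]
    refine lintegral_congr fun y => ?_
    rw [hsplit, ENNReal.ofReal_mul (hg0 _)]
  -- AM–GM in the form √g ≤ (gm + 1)/(2√m); integrating it gives exactly 1/√m.
  have hpt : ∀ y : ℝ × ℝ, ENNReal.ofReal (√(M.stepRatio κ v i y)) ≤
      (ENNReal.ofReal ((2 * √m)⁻¹) * (ENNReal.ofReal (g y.1) * ENNReal.ofReal m + 1)) *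
        ENNReal.ofReal (Real.exp (κ / 2 * y.2)) := by
    intro y
    rw [← ENNReal.ofReal_mul (hg0 _), ← ENNReal.ofReal_one,
      ← ENNReal.ofReal_add (mul_nonneg (hg0 _) hm0.le) zero_le_one,
      ← ENNReal.ofReal_mul (by positivity),
      ← ENNReal.ofReal_mul (mul_nonneg (by positivity) (by have := hg0 y.1; positivity))]
    refine ENNReal.ofReal_le_ofReal ?_
    rw [hsplit, Real.sqrt_mul (hg0 _), ← Real.exp_half, mul_div_right_comm]
    refine mul_le_mul_of_nonneg_right ?_ (Real.exp_nonneg _)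
    rw [le_inv_mul_iff₀ (by positivity)]
    nlinarith [sq_nonneg (√m * √(g y.1) - 1), Real.sq_sqrt hm0.le, Real.sq_sqrt (hg0 y.1)]
  calc _ ≤ _ := lintegral_mono hpt
    _ = ENNReal.ofReal ((2 * √m)⁻¹) * 2 * ENNReal.ofReal (M.beta / (M.beta - κ / 2)) := by
      rw [lintegral_claimKernel_mul i (f := fun t =>
          ENNReal.ofReal ((2 * √m)⁻¹) * (ENNReal.ofReal (g t) * ENNReal.ofReal m + 1))
          (by fun_prop) (measurable_ofReal_exp_mul (κ / 2)),
        lintegral_exp_mul_expMeasure hβ (by linarith), lintegral_const_mul _ (by fun_prop),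
        lintegral_add_right _ measurable_const, lintegral_mul_const _ (by fun_prop), hgint]
      simp [one_add_one_eq_two]
    _ = ENNReal.ofReal (sqrtRate M κ) := by
      rw [← ENNReal.ofReal_ofNat 2, ← ENNReal.ofReal_mul (by positivity),
        ← ENNReal.ofReal_mul (by positivity), sqrtRate]
      congr 2
      rw [← hm]
      field_simp

lemma lintegral_sqrt_likelihood_le (hκ : 0 < κ) (hb : κ < M.beta) (hpos : ∀ i j, 0 < v i / v j)
    (hev : M.kernelMatrix κ *ᵥ v = v) (i : Fin 2) (n : ℕ) :
    ∫⁻ ω, ENNReal.ofReal (√(M.likelihood κ v n ω)) ∂(M.pathLaw i) ≤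
      ENNReal.ofReal (sqrtRate M κ) ^ n := by
  rw [pathLaw_eq_chainLaw]
  refine lintegral_chainLaw_le_pow
    (F := fun n ω => ENNReal.ofReal (√(M.likelihood κ v n ω)))
    (fun n => (M.measurable_likelihood κ v n).sqrt.ennreal_ofReal)
    (fun n ω ω' h => by simp only [M.dependsOn_likelihood κ v n h])
    (u := fun j y => ENNReal.ofReal (√(M.stepRatio κ v j y)))
    (fun j => (M.measurable_stepRatio κ v j).sqrt.ennreal_ofReal)
    (lintegral_sqrt_stepRatio_le hκ hb hpos hev)
    (fun ω => by simp [likelihood_zero hpos]) (fun n ω => ?_) n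
  rw [likelihood_succ hpos, Real.sqrt_mul (likelihood_pos hpos n ω).le,
    ENNReal.ofReal_mul (Real.sqrt_nonneg _)]

/-- The tilted additive component exceeds every level. -/
lemma tilted_ae_exists_lt_S [IsMarkovKernel (M.tiltedKernel κ v)] (hκ : 0 < κ) (hb : κ < M.beta)
    (hpos : ∀ i j, 0 < v i / v j) (hev : M.kernelMatrix κ *ᵥ v = v) (i : Fin 2) (x : ℝ) :
    ∀ᵐ ω ∂(M.chainLaw (M.tiltedKernel κ v) i), ∃ n, x < S n ω := by
  -- The sum of all (positive) ratios dominates whichever ratio occurs in `likelihood`.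
  set C := Real.exp (κ * x) * ∑ i, ∑ j, v i / v j with hC
  have hL : ∀ n ω, S n ω ≤ x → M.likelihood κ v n ω ≤ C := by
    intro n ω h
    refine mul_le_mul (Real.exp_le_exp.2 (by nlinarith)) ?_ (hpos _ _).le (Real.exp_nonneg _)
    calc _ ≤ ∑ j, v (M.J n ω) / v j := Finset.single_le_sum
          (f := fun j => v (M.J n ω) / v j) (fun j _ => (hpos _ j).le) (Finset.mem_univ _)
      _ ≤ _ := Finset.single_le_sum (f := fun i => ∑ j, v i / v j)
          (fun i _ => Finset.sum_nonneg fun j _ => (hpos i j).le) (Finset.mem_univ _)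
  have hbound : ∀ n, M.chainLaw (M.tiltedKernel κ v) i {ω | ∃ n, x < S n ω}ᶜ ≤
      ENNReal.ofReal (√C) * ENNReal.ofReal (sqrtRate M κ) ^ n := by
    intro n
    have hm : MeasurableSet {ω | S n ω ≤ x} := measurableSet_le (measurable_S n) measurable_const
    calc _ ≤ M.chainLaw (M.tiltedKernel κ v) i {ω | S n ω ≤ x} := by
          refine measure_mono fun ω hω => ?_
          by_contra h
          exact hω ⟨n, not_le.1 h⟩
      _ = ∫⁻ ω, {ω | S n ω ≤ x}.indicator 1 ω * ENNReal.ofReal (M.likelihood κ v n ω)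
            ∂(M.pathLaw i) := by
          rw [← lintegral_indicator_one hm]
          refine lintegral_chainLaw_tiltedKernel hpos i n (measurable_one.indicator hm) ?_
          intro ω ω' h
          simp [Set.indicator_apply, dependsOn_S le_rfl h]
      -- L ≤ C implies L = √L·√L ≤ √C·√L.
      _ ≤ ∫⁻ ω, ENNReal.ofReal (√C) * ENNReal.ofReal (√(M.likelihood κ v n ω)) ∂(M.pathLaw i) := by
          refine lintegral_mono fun ω => ?_
          by_cases h : S n ω ≤ x
          · rw [Set.indicator_of_mem (by exact h), Pi.one_apply, one_mul,
              ← ENNReal.ofReal_mul (Real.sqrt_nonneg _)]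
            refine ENNReal.ofReal_le_ofReal ?_
            have hp := (likelihood_pos (M := M) (κ := κ) hpos n ω).le
            calc _ = √(M.likelihood κ v n ω) * √(M.likelihood κ v n ω) :=
                  (Real.mul_self_sqrt hp).symm
              _ ≤ _ := by gcongr; exact hL n ω h
          · rw [Set.indicator_of_notMem (by exact h), zero_mul]
            exact zero_le
      _ = ENNReal.ofReal (√C) * ∫⁻ ω, ENNReal.ofReal (√(M.likelihood κ v n ω)) ∂(M.pathLaw i) :=
          lintegral_const_mul _ (M.measurable_likelihood κ v n).sqrt.ennreal_ofReal
      _ ≤ _ := by gcongr; exact lintegral_sqrt_likelihood_le hκ hb hpos hev i n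
  have hr : ENNReal.ofReal (sqrtRate M κ) < 1 := by
    rw [ENNReal.ofReal_lt_one]
    exact sqrtRate_lt_one hκ hb
  have htend := ENNReal.Tendsto.const_mul (ENNReal.tendsto_pow_atTop_nhds_zero_of_lt_one hr)
    (Or.inr (ENNReal.ofReal_ne_top (r := √C)))
  rw [mul_zero] at htend
  exact le_antisymm (ge_of_tendsto' htend hbound) zero_le

/-! ### Ruin and passage of the embedded process -/

lemma claimKernel_ae_pos (i : Fin 2) : ∀ᵐ y ∂(M.claimKernel i), 0 < y.1 := by
  rw [claimKernel_apply]
  exact Measure.quasiMeasurePreserving_fst.ae (ae_expMeasure_pos _)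

lemma pathLaw_ae_pos (i : Fin 2) : ∀ᵐ ω ∂(M.pathLaw i), ∀ n, 0 < (ω (n + 1)).1 :=
  ae_all_iff.2 fun n => chainLaw_ae_succ (p := fun y => 0 < y.1)
    (measurableSet_lt measurable_const measurable_fst) claimKernel_ae_pos n

lemma claimEpoch_zero (ω : ClaimPath) : claimEpoch 0 ω = 0 := by simp [claimEpoch]

lemma claimEpoch_succ (n : ℕ) (ω : ClaimPath) :
    claimEpoch (n + 1) ω = claimEpoch n ω + (ω (n + 1)).1 := Finset.sum_Icc_succ_top (by omega) _

lemma measurable_claimEpoch (n : ℕ) : Measurable (claimEpoch n) := by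
  unfold claimEpoch
  fun_prop

lemma dependsOn_claimEpoch (n : ℕ) : DependsOn (claimEpoch n) (Set.Iic n) := by
  intro ω ω' h
  refine Finset.sum_congr rfl fun j hj => ?_
  rw [h j (Finset.mem_Icc.1 hj).2]

/-- The claim epochs are unbounded. -/
lemma pathLaw_ae_exists_lt_claimEpoch (i : Fin 2) (K : ℝ) :
    ∀ᵐ ω ∂(M.pathLaw i), ∃ n, K < claimEpoch n ω := by
  -- The larger of the two Laplace transforms of the inter-claim times at 1; a Chernoff bound for
  -- the event that the n-th epoch is at most K then decays like `q ^ n`.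
  set q : ℝ := max (M.lam1 / (M.lam1 + 1)) (M.lam2 / (M.lam2 + 1)) with hq
  have hq1 : q < 1 := by
    have h1 := M.lam1_pos
    have h2 := M.lam2_pos
    refine max_lt ?_ ?_ <;> rw [div_lt_one (by positivity)] <;> linarith
  have hmean : ∀ n, ∫⁻ ω, ENNReal.ofReal (Real.exp (-1 * claimEpoch n ω)) ∂(M.pathLaw i) ≤
      ENNReal.ofReal q ^ n := by
    intro n
    rw [pathLaw_eq_chainLaw]
    refine lintegral_chainLaw_le_pow
      (F := fun n ω => ENNReal.ofReal (Real.exp (-1 * claimEpoch n ω)))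
      (fun n => (measurable_ofReal_exp_mul (-1)).comp (measurable_claimEpoch n))
      (fun n ω ω' h => by simp only [dependsOn_claimEpoch n h])
      (u := fun _ y => ENNReal.ofReal (Real.exp (-1 * y.1)))
      (fun _ => (measurable_ofReal_exp_mul (-1)).comp measurable_fst)
      (fun j => ?_) (fun ω => by simp [claimEpoch_zero]) (fun n ω => ?_) n
    · have h := lintegral_claimKernel_mul (M := M) j (measurable_ofReal_exp_mul (-1))
        (measurable_const (a := (1 : ℝ≥0∞)))
      simp only [mul_one, lintegral_one, measure_univ] at h
      rw [h, lintegral_exp_mul_expMeasure (M.rate_pos j) (by linarith [M.rate_pos j]), hq]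
      refine ENNReal.ofReal_le_ofReal ?_
      rw [sub_neg_eq_add]
      fin_cases j
      · exact le_max_left _ _
      · exact le_max_right _ _
    · rw [claimEpoch_succ, mul_add, Real.exp_add, ENNReal.ofReal_mul (Real.exp_nonneg _)]
  have hbound : ∀ n, M.pathLaw i {ω | ∃ n, K < claimEpoch n ω}ᶜ ≤
      ENNReal.ofReal (Real.exp K) * ENNReal.ofReal q ^ n := by
    intro n
    have hm : MeasurableSet {ω | claimEpoch n ω ≤ K} :=
      measurableSet_le (measurable_claimEpoch n) measurable_const
    calc _ ≤ M.pathLaw i {ω | claimEpoch n ω ≤ K} := by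
          refine measure_mono fun ω hω => ?_
          by_contra h
          exact hω ⟨n, not_le.1 h⟩
      _ = ∫⁻ ω, {ω | claimEpoch n ω ≤ K}.indicator 1 ω ∂(M.pathLaw i) :=
          (lintegral_indicator_one hm).symm
      _ ≤ ∫⁻ ω, ENNReal.ofReal (Real.exp K) * ENNReal.ofReal (Real.exp (-1 * claimEpoch n ω))
            ∂(M.pathLaw i) := by
          refine lintegral_mono fun ω => ?_
          by_cases h : claimEpoch n ω ≤ K
          · rw [Set.indicator_of_mem (by exact h), ← ENNReal.ofReal_mul (Real.exp_nonneg _),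
              ← Real.exp_add, Pi.one_apply, ENNReal.one_le_ofReal]
            exact Real.one_le_exp (by linarith)
          · rw [Set.indicator_of_notMem (by exact h)]
            exact zero_le
      _ = _ := lintegral_const_mul _
          ((measurable_ofReal_exp_mul (-1)).comp (measurable_claimEpoch n))
      _ ≤ _ := by gcongr; exact hmean n
  have htend := ENNReal.Tendsto.const_mul
    (ENNReal.tendsto_pow_atTop_nhds_zero_of_lt_one (ENNReal.ofReal_lt_one.2 hq1))
    (Or.inr (ENNReal.ofReal_ne_top (r := Real.exp K)))
  rw [mul_zero] at htend
  exact le_antisymm (ge_of_tendsto' htend hbound) zero_le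

lemma strictMono_claimEpoch {ω : ClaimPath} (hω : ∀ n, 0 < (ω (n + 1)).1) :
    StrictMono fun n => claimEpoch n ω :=
  strictMono_nat_of_lt_succ fun n => by rw [claimEpoch_succ]; linarith [hω n]

lemma claimCount_eq {ω : ClaimPath} (hω : ∀ n, 0 < (ω (n + 1)).1) {t : ℝ} {n : ℕ}
    (h1 : claimEpoch n ω ≤ t) (h2 : t < claimEpoch (n + 1) ω) : claimCount t ω = n := by
  have hmono := strictMono_claimEpoch hω
  have : {k : ℕ | 1 ≤ k ∧ claimEpoch k ω ≤ t} = Finset.Icc 1 n := by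
    ext k
    simp only [Finset.coe_Icc, Set.mem_Icc, Set.mem_ofPred_eq, and_congr_right_iff]
    intro _
    refine ⟨fun h => ?_, fun h => (hmono.monotone h).trans h1⟩
    have := hmono.lt_iff_lt.1 (h.trans_lt h2)
    omega
  rw [claimCount, this, Set.ncard_coe_finset]
  simp

lemma claimEpoch_sub (n : ℕ) (ω : ClaimPath) :
    claimEpoch n ω - ∑ k ∈ Finset.Icc 1 n, (ω k).2 = -S n ω := by
  rw [claimEpoch, S, ← Finset.sum_sub_distrib, ← Finset.sum_neg_distrib]
  exact Finset.sum_congr rfl fun _ _ => by ring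

/-- Ruin occurs at a claim, so that it is a passage of `S` above the initial reserve. -/
lemma ruinTime_lt_top_iff {ω : ClaimPath} (hω : ∀ n, 0 < (ω (n + 1)).1)
    (hunb : ∀ K : ℕ, ∃ n, (K : ℝ) < claimEpoch n ω) (x : ℝ) :
    ruinTime x ω < ∞ ↔ ∃ n, x < S n ω := by
  have hmono := strictMono_claimEpoch hω
  have h0 : ruinTime x ω < ∞ ↔ ∃ t, 0 ≤ t ∧ surplus x t ω < 0 := by
    rw [ruinTime, sInf_lt_iff]
    constructor
    · rintro ⟨_, ⟨t, ht, rfl⟩, -⟩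
      exact ⟨t, ht⟩
    · rintro ⟨t, ht⟩
      exact ⟨_, ⟨t, ht, rfl⟩, ENNReal.ofReal_lt_top⟩
  rw [h0]
  constructor
  · rintro ⟨t, ht, hU⟩
    -- At the last epoch σ_n ≤ t the surplus is x - S_n, and it has only grown since; so a negative
    -- value at t forces S_n > x.
    obtain ⟨n, h1, h2⟩ : ∃ n, claimEpoch n ω ≤ t ∧ t < claimEpoch (n + 1) ω := by
      have hex : ∃ n, t < claimEpoch n ω := by
        obtain ⟨K, hK⟩ := exists_nat_gt t
        obtain ⟨n, hn⟩ := hunb K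
        exact ⟨n, hK.trans hn⟩
      classical
      obtain ⟨n, hn⟩ : ∃ n, Nat.find hex = n + 1 := by
        refine Nat.exists_eq_succ_of_ne_zero fun h => ?_
        have := Nat.find_spec hex
        rw [h, claimEpoch_zero] at this
        linarith
      exact ⟨n, not_lt.1 (Nat.find_min hex (by omega)), hn ▸ Nat.find_spec hex⟩
    refine ⟨n, ?_⟩
    rw [surplus, claimCount_eq hω h1 h2] at hU
    linarith [claimEpoch_sub n ω]
  · rintro ⟨n, hn⟩
    refine ⟨claimEpoch n ω, ?_, ?_⟩
    · rw [← claimEpoch_zero ω]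
      exact hmono.monotone (Nat.zero_le n)
    · rw [surplus, claimCount_eq hω le_rfl (hmono (Nat.lt_succ_self n))]
      linarith [claimEpoch_sub n ω]

lemma ruinProb_eq (x : ℝ) : M.ruinProb x = (M.pathLaw 1).real {ω | ∃ n, x < S n ω} := by
  refine measureReal_congr ?_
  filter_upwards [pathLaw_ae_pos (M := M) 1,
    -- Integer levels keep the intersection of almost sure events countable.
    ae_all_iff.2 fun K : ℕ => pathLaw_ae_exists_lt_claimEpoch (M := M) 1 K] with ω h1 h2
  exact propext (ruinTime_lt_top_iff h1 h2 x)

end BonusModel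


/-! ### First passage and Siegmund's identity -/

namespace BonusModel

variable {M : BonusModel} {κ : ℝ} {v : Fin 2 → ℝ}

/-- The event that the first passage above `x` occurs at `n`. -/
def passageAt (x : ℝ) (n : ℕ) : Set ClaimPath := {ω | x < S n ω ∧ ∀ k < n, S k ω ≤ x}

lemma measurableSet_passageAt (x : ℝ) (n : ℕ) : MeasurableSet (passageAt x n) := by
  have : passageAt x n = {ω | x < S n ω} ∩ ⋂ k, ⋂ _ : k < n, {ω | S k ω ≤ x} := by
    ext ω
    simp [passageAt]
  rw [this]
  exact (measurableSet_lt measurable_const (measurable_S n)).inter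
    (.iInter fun k => .iInter fun _ => measurableSet_le (measurable_S k) measurable_const)

lemma dependsOn_passageAt (x : ℝ) (n : ℕ) : DependsOn (· ∈ passageAt x n) (Set.Iic n) := by
  intro ω ω' h
  have h1 : ∀ k ≤ n, S k ω = S k ω' := fun k hk => dependsOn_S hk h
  simp only [passageAt, Set.mem_ofPred_eq, eq_iff_iff, h1 n le_rfl]
  refine and_congr_right fun _ => forall_congr' fun k => forall_congr' fun hk => ?_
  rw [h1 k hk.le]

lemma pairwise_disjoint_passageAt (x : ℝ) :
    Pairwise (Function.onFun Disjoint (passageAt x)) :=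
  (pairwise_disjoint_on _).2 fun m _ hmn => Set.disjoint_left.2 fun _ h1 h2 =>
    absurd h1.1 (not_lt.2 (h2.2 m hmn))

lemma iUnion_passageAt (x : ℝ) : ⋃ n, passageAt x n = {ω | ∃ n, x < S n ω} := by
  ext ω
  simp only [Set.mem_iUnion, Set.mem_ofPred_eq]
  refine ⟨fun ⟨n, hn⟩ => ⟨n, hn.1⟩, fun h => ?_⟩
  classical
  exact ⟨Nat.find h, Nat.find_spec h, fun k hk => not_lt.1 (Nat.find_min h hk)⟩

lemma restrict_iUnion_passageAt {Q : Measure ClaimPath} {x : ℝ}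
    (hQ : ∀ᵐ ω ∂Q, ∃ n, x < S n ω) : Q.restrict (⋃ n, passageAt x n) = Q := by
  refine Measure.restrict_eq_self_of_ae_mem ?_
  rw [iUnion_passageAt]
  exact hQ

lemma passageTime_eq {x : ℝ} {n : ℕ} {ω : ClaimPath} (h : ω ∈ passageAt x n) :
    passageTime x ω = n := by
  have hle : ∀ k : ℕ, passageTime x ω ≤ k ↔ ∃ j ∈ Set.Icc 0 k, S j ω ∈ Set.Ioi x := fun k =>
    hittingAfter_le_iff
  refine le_antisymm ((hle n).2 ⟨n, by simp, h.1⟩) ?_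
  by_contra! hlt
  obtain ⟨k, hk⟩ := WithTop.ne_top_iff_exists.1 hlt.ne_top
  obtain ⟨j, hj, hjx⟩ := (hle k).1 hk.symm.le
  rw [← hk, Nat.cast_withTop, WithTop.coe_lt_coe] at hlt
  exact absurd hjx (not_lt.2 (h.2 j (hj.2.trans_lt hlt)))

lemma overshoot_eq {x : ℝ} {n : ℕ} {ω : ClaimPath} (h : ω ∈ passageAt x n) :
    overshoot x ω = S n ω - x := by
  rw [overshoot, passageValue, stoppedValue, passageTime_eq h]
  rfl

lemma passageState_eq {x : ℝ} {n : ℕ} {ω : ClaimPath} (h : ω ∈ passageAt x n) :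
    M.passageState x ω = M.J n ω := by
  rw [passageState, stoppedValue, passageTime_eq h]
  rfl

/-- The functional of the overshoot that appears in the ruin formula. -/
def passageFunctional (M : BonusModel) (κ : ℝ) (v : Fin 2 → ℝ) (x : ℝ) (ω : ClaimPath) : ℝ :=
  Real.exp (-κ * overshoot x ω) / v (M.passageState x ω)

lemma passageFunctional_eq {x : ℝ} {n : ℕ} {ω : ClaimPath} (h : ω ∈ passageAt x n) :
    passageFunctional M κ v x ω = Real.exp (-κ * (S n ω - x)) / v (M.J n ω) := by
  rw [passageFunctional, overshoot_eq h, passageState_eq h]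

/-- On each passage event the functional agrees with a measurable function of `S n` and `J n`, and
these countably many events carry `Q`. -/
lemma aemeasurable_passageFunctional {Q : Measure ClaimPath} {x : ℝ}
    (hQ : ∀ᵐ ω ∂Q, ∃ n, x < S n ω) : AEMeasurable (passageFunctional M κ v x) Q := by
  rw [← restrict_iUnion_passageAt hQ, aemeasurable_iUnion_iff]
  intro n
  have h1 : Measurable fun ω : ClaimPath => v (M.J n ω) :=
    (measurable_from_top (f := v)).comp (M.measurable_J n)
  have h2 : Measurable fun ω => Real.exp (-κ * (S n ω - x)) / v (M.J n ω) :=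
    (((measurable_S n).sub_const x).const_mul (-κ)).exp.div h1
  refine h2.aemeasurable.congr ?_
  filter_upwards [ae_restrict_mem (measurableSet_passageAt x n)] with ω hω
    using (passageFunctional_eq hω).symm

/-- The overshoot is positive, so the exponential is at most 1. -/
lemma abs_passageFunctional_le (hκ : 0 < κ) {x : ℝ} {ω : ClaimPath} (h : ∃ n, x < S n ω) :
    ‖passageFunctional M κ v x ω‖ ≤ ∑ j, |v j|⁻¹ := by
  have h' : ω ∈ ⋃ n, passageAt x n := by rwa [iUnion_passageAt]
  obtain ⟨n, hn⟩ := Set.mem_iUnion.1 h'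
  rw [passageFunctional_eq hn, Real.norm_eq_abs, abs_div, Real.abs_exp, div_eq_mul_inv]
  calc _ ≤ 1 * |v (M.J n ω)|⁻¹ := by
        gcongr
        exact Real.exp_le_one_iff.2 (by nlinarith [hn.1])
    _ ≤ _ := by
        rw [one_mul]
        exact Finset.single_le_sum (f := fun j => |v j|⁻¹) (fun j _ => by positivity)
          (Finset.mem_univ _)

lemma integrable_passageFunctional (hκ : 0 < κ) {Q : Measure ClaimPath} [IsFiniteMeasure Q] {x : ℝ}
    (hQ : ∀ᵐ ω ∂Q, ∃ n, x < S n ω) : Integrable (passageFunctional M κ v x) Q :=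
  .of_bound (aemeasurable_passageFunctional hQ).aestronglyMeasurable _
    (hQ.mono fun _ => abs_passageFunctional_le hκ)

/-- Siegmund's identity: the passage probability as a mean under the tilted law. -/
lemma pathLaw_exists_lt_S [IsMarkovKernel (M.tiltedKernel κ v)] (hpos : ∀ i j, 0 < v i / v j)
    {i : Fin 2} {x : ℝ} (hQ : ∀ᵐ ω ∂(M.chainLaw (M.tiltedKernel κ v) i), ∃ n, x < S n ω) :
    M.pathLaw i {ω | ∃ n, x < S n ω} = ∫⁻ ω, ENNReal.ofReal
      (v i * Real.exp (-κ * x) * passageFunctional M κ v x ω)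
        ∂(M.chainLaw (M.tiltedKernel κ v) i) := by
  rw [← iUnion_passageAt, measure_iUnion (pairwise_disjoint_passageAt x) (measurableSet_passageAt x),
    ← restrict_iUnion_passageAt hQ,
    lintegral_iUnion (measurableSet_passageAt x) (pairwise_disjoint_passageAt x)]
  refine tsum_congr fun n => ?_
  -- The change of measure is applied to 1/L_n on the event of passage at n, which turns the
  -- P-probability of that event into a Q-mean.
  set F : ClaimPath → ℝ≥0∞ := (passageAt x n).indicator
    fun ω => ENNReal.ofReal (M.likelihood κ v n ω)⁻¹ with hF
  have hFm : Measurable F :=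
    (M.measurable_likelihood κ v n).inv.ennreal_ofReal.indicator (measurableSet_passageAt x n)
  have hFd : DependsOn F (Set.Iic n) := by
    intro ω ω' h
    have h1 : ω ∈ passageAt x n ↔ ω' ∈ passageAt x n := iff_of_eq (dependsOn_passageAt x n h)
    by_cases h2 : ω' ∈ passageAt x n <;> simp [hF, h1, h2, M.dependsOn_likelihood κ v n h]
  have h1 : ∫⁻ ω, F ω * ENNReal.ofReal (M.likelihood κ v n ω) ∂(M.pathLaw i) =
      M.pathLaw i (passageAt x n) := by
    rw [← lintegral_indicator_one (measurableSet_passageAt x n)]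
    refine lintegral_congr fun ω => ?_
    by_cases h : ω ∈ passageAt x n
    · have hL := likelihood_pos (M := M) (κ := κ) hpos n ω
      simp only [hF, Set.indicator_of_mem h, Pi.one_apply]
      rw [← ENNReal.ofReal_mul (inv_nonneg.2 hL.le), inv_mul_cancel₀ hL.ne', ENNReal.ofReal_one]
    · simp [hF, h]
  rw [← h1, ← lintegral_chainLaw_tiltedKernel hpos i n hFm hFd,
    lintegral_indicator (measurableSet_passageAt x n)]
  refine lintegral_congr_ae ?_
  filter_upwards [ae_restrict_mem (measurableSet_passageAt x n), ae_restrict_of_ae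
    (chainLaw_ae_J_zero (M := M) (η := M.tiltedKernel κ v) (i := i))] with ω hω h0
  -- Since J_0 = i almost surely, 1/L_n = e^{-κS_n} v_i / v_{J_n}; the factors e^{-κx} and e^{κx}
  -- cancel.
  have e : -κ * (S n ω - x) = κ * x + -(κ * S n ω) := by ring
  rw [passageFunctional_eq hω, likelihood, h0, e, Real.exp_add, Real.exp_neg, neg_mul, Real.exp_neg]
  congr 1
  field_simp

end BonusModel

end

theorem mainTheorem1 (M : BonusModel) (κ : ℝ) (hκ : M.IsAdjustmentCoefficient κ)
    (v : Fin 2 → ℝ) (hv : v ≠ 0) (hev : M.kernelMatrix κ *ᵥ v = v) :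
    ∃ Q : Measure ClaimPath, M.IsTiltedLaw κ v 1 Q ∧
      (∀ Q' : Measure ClaimPath, M.IsTiltedLaw κ v 1 Q' → Q' = Q) ∧
      ∀ x : ℝ, 0 ≤ x →
        (∀ᵐ ω ∂Q, BonusModel.passageTime x ω < ⊤) ∧
        Integrable (fun ω => Real.exp (-κ * BonusModel.overshoot x ω) /
          v (M.passageState x ω)) Q ∧
        M.ruinProb x = v 1 * Real.exp (-κ * x) *
          ∫ ω, Real.exp (-κ * BonusModel.overshoot x ω) / v (M.passageState x ω) ∂Q := by
  have hb := BonusModel.lt_beta_of_eigenvector hv hev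
  have hpos := BonusModel.eigenvector_div_pos hκ hv hev
  have := BonusModel.isMarkovKernel_tiltedKernel hκ.1 hb hpos hev
  have htilt := BonusModel.isTiltedLaw_chainLaw (M := M) (κ := κ) hpos 1
  refine ⟨M.chainLaw (M.tiltedKernel κ v) 1, htilt, fun Q' hQ' => htilt.unique hQ', fun x _ => ?_⟩
  have hQ := BonusModel.tilted_ae_exists_lt_S hκ.1 hb hpos hev 1 x
  refine ⟨?_, BonusModel.integrable_passageFunctional hκ.1 hQ, ?_⟩
  · filter_upwards [hQ] with ω hω
    have h' : ω ∈ ⋃ n, BonusModel.passageAt x n := by rwa [BonusModel.iUnion_passageAt]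
    obtain ⟨n, hn⟩ := Set.mem_iUnion.1 h'
    rw [BonusModel.passageTime_eq hn]
    exact WithTop.coe_lt_top n
  · rw [BonusModel.ruinProb_eq, Measure.real, BonusModel.pathLaw_exists_lt_S hpos hQ,
      ← integral_const_mul]
    refine (integral_eq_lintegral_of_nonneg_ae ?_
      ((BonusModel.aemeasurable_passageFunctional hQ).const_mul _).aestronglyMeasurable).symm
    refine .of_forall fun ω => ?_
    -- `v` may be negative, so nonnegativity comes from the ratio of its entries.
    have h1 := (hpos 1 (M.passageState x ω)).le
    have e : v 1 * Real.exp (-κ * x) * BonusModel.passageFunctional M κ v x ω =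
        v 1 / v (M.passageState x ω) * (Real.exp (-κ * x) * Real.exp (-κ * BonusModel.overshoot x ω)) := by
      rw [BonusModel.passageFunctional]
      ring
    change 0 ≤ v 1 * Real.exp (-κ * x) * BonusModel.passageFunctional M κ v x ω
    rw [e]
    positivity
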